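/- \textbf{Theorem.} Let $T=(V,E)$ be a finite tree with an arbitrary root $r\in V$, and let $A,B\subseteq V$ with $|A|=|B|$ be the set of starting nodes of the (interchangeable) agents and the set of targets. Let $T_u$ be the subtree of descendants of $u$ (including $u$). Consider the following algorithm, which maintains for each node $u$ a demand $d(u)\in\mathbb Z$, initially $|B\cap T_u|-|A\cap T_u|$, a list $l(u)$ of timesteps, initially empty, an integer $s(u)$, initially $0$, and a mark "processed", initially absent; put $\max l(u)=0$ if $l(u)$ is empty. $\mathit{send\_agent}(u,t)$: If $d(u)<0$, append $t+1$ to $l(parent(u))$, output the move $(u,parent(u),t)$ and increase $d(u)$ by $1$. Otherwise, if some child $v$ of $u$ has $d(v)>0$, pick any such $v$, append $t+1$ to $l(v)$, output the move $(u,v,t)$ and decrease $d(v)$ by $1$. Otherwise do nothing. $\mathit{direct\_traffic}(u)$ (also called $\mathit{process\_subtree}$): (1) if $u\in A$, insert $s(u)$ at the start of $l(u)$; (2) for each child $v$ of $u$ with $d(v)<0$, in any order, set $s(v)\leftarrow\max(s(u)-1,\max l(u),0)$ and call $\mathit{direct\_traffic}(v)$; (3) for each $t$ in $l(u)$, in list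 order, call $\mathit{send\_agent}(u,t)$; (4) mark $u$ as processed; (5) for each child $v$ of $u$ not yet processed, in any order, call $\mathit{direct\_traffic}(v)$. Then, however the children are picked and ordered, the call $\mathit{direct\_traffic}(r)$ terminates and the moves it outputs form a feasible, collision-free plan for unlabeled multi-agent path finding (MAPF) on $T$. That is, no move is output twice, and there are positions $p_a(t)\in V$ of the agents $a\in A$ at the timesteps $t=0,1,2,\dots$ such that: (i) $p_a(0)=a$, and in each timestep $a$ stays where it is or moves along an edge of $T$; (ii) the output moves are exactly the triples $(p_a(t),p_a(t+1),t)$ with $p_a(t+1)\ne p_a(t)$; (iii) every agent ends at a target: for each $a$ there is $b\in B$ with $p_a(t)=b$ for all sufficiently large $t$; (iv) no two agents occupy a vertex at the same time: $p_a(t)\neq p_{a'}(t)$ for all $t$ if $a\ne a'$; (v) no two agents swap along an edge: if $a\neq a'$, there is no $t$ with $p_a(t+1)=p_{a'}(t)$ and $p_{a'}(t+1)=p_a(t)$. -/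

import Mathlib

namespace TreeMAPF

/-! ### Rooted trees -/

section RootedTree

variable {V : Type*}

/-- `v` is a child of `u` in the graph `G` (a tree) rooted at `r`. -/
def IsChild (G : SimpleGraph V) (r u v : V) : Prop :=
  G.Adj u v ∧ G.dist r v = G.dist r u + 1

/-- `v` is a node of the subtree `T_u` rooted at `u`. -/
def InSubtree (G : SimpleGraph V) (r u v : V) : Prop :=
  Relation.ReflTransGen (IsChild G r) u v

open Classical in
/-- The parent of `u`; the value at the root, which has no parent, is irrelevant. -/
noncomputable def parent (G : SimpleGraph V) (r u : V) : V :=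
  if h : ∃ p, IsChild G r p u then h.choose else u

open Classical in
/-- The initial demand: the number of targets minus the number of agents in `T_u`. -/
noncomputable def initialDemand (G : SimpleGraph V) (r : V) (agents targets : Finset V)
    (u : V) : ℤ :=
  ((targets.filter (InSubtree G r u)).card : ℤ) - ((agents.filter (InSubtree G r u)).card : ℤ)

end RootedTree

/-! ### The algorithm -/

/-- A timed move `(src, dst, time)`: the agent which is at `src` at timestep `time` is at `dst`
at timestep `time + 1`. -/
structure Move (V : Type*) where
  src : V
  dst : V
  time : ℕ

/-- The variables of the algorithm: the current demands `d`, the lists `l`, the earliest departure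
times `s`, the set of nodes marked as processed, and the moves output so far. -/
structure State (V : Type*) where
  d : V → ℤ
  l : V → List ℕ
  s : V → ℕ
  processed : Finset V
  out : List (Move V)

/-- The maximum of a list of timesteps, which is `0` for the empty list. -/
def maxTime (L : List ℕ) : ℕ := L.foldr max 0

/-- A resolution of the choices that the algorithm leaves open: the child that `sendAgent` picks,
and the orders in which the two loops over children in `directTraffic` are run. All of them may
depend on the whole current state. -/
structure Choices {V : Type*} (G : SimpleGraph V) (r : V) where
  pick : State V → V → V
  pick_spec : ∀ σ u, (∃ v, IsChild G r u v ∧ 0 < σ.d v) →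
    IsChild G r u (pick σ u) ∧ 0 < σ.d (pick σ u)
  negOrder : State V → V → List V
  negOrder_nodup : ∀ σ u, (negOrder σ u).Nodup
  mem_negOrder : ∀ σ u v, v ∈ negOrder σ u ↔ IsChild G r u v ∧ σ.d v < 0
  restOrder : State V → V → List V
  restOrder_nodup : ∀ σ u, (restOrder σ u).Nodup
  mem_restOrder : ∀ σ u v, v ∈ restOrder σ u ↔ IsChild G r u v ∧ v ∉ σ.processed

open Classical in
/-- The open choices can always be resolved. -/
theorem nonempty_choices {V : Type*} [Fintype V] (G : SimpleGraph V) (r : V) :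
    Nonempty (Choices G r) :=
  ⟨{ pick := fun σ u => if h : ∃ v, IsChild G r u v ∧ 0 < σ.d v then h.choose else u
     pick_spec := fun σ u h => by
       simp only [dif_pos h]
       exact h.choose_spec
     negOrder := fun σ u => (Finset.univ.filter fun v => IsChild G r u v ∧ σ.d v < 0).toList
     negOrder_nodup := fun _ _ => Finset.nodup_toList _
     mem_negOrder := by simp
     restOrder := fun σ u => (Finset.univ.filter fun v => IsChild G r u v ∧ v ∉ σ.processed).toList
     restOrder_nodup := fun _ _ => Finset.nodup_toList _
     mem_restOrder := by simp }⟩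

section Algorithm

variable {V : Type*} [DecidableEq V] {G : SimpleGraph V} {r : V}

open Classical in
/-- `send_agent(u, t)`. -/
noncomputable def sendAgent (c : Choices G r) (u : V) (t : ℕ) (σ : State V) : State V :=
  if σ.d u < 0 then
    { σ with
      l := Function.update σ.l (parent G r u) (σ.l (parent G r u) ++ [t + 1])
      out := σ.out ++ [⟨u, parent G r u, t⟩]
      d := Function.update σ.d u (σ.d u + 1) }
  else if ∃ v, IsChild G r u v ∧ 0 < σ.d v then
    let v := c.pick σ u
    { σ with
      l := Function.update σ.l v (σ.l v ++ [t + 1])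
      out := σ.out ++ [⟨u, v, t⟩]
      d := Function.update σ.d v (σ.d v - 1) }
  else σ

/-- If `u` initially holds an agent, insert `s(u)` at the start of `l(u)`. -/
def insertOwn (agents : Finset V) (u : V) (σ : State V) : State V :=
  if u ∈ agents then { σ with l := Function.update σ.l u (σ.s u :: σ.l u) } else σ

/-- `s(v) ← max(s(u) - 1, max l(u), 0)`; natural subtraction accounts for the `0`. -/
def setStart (u v : V) (σ : State V) : State V :=
  { σ with s := Function.update σ.s v (max (σ.s u - 1) (maxTime (σ.l u))) }

/-- Mark `u` as processed. -/
def markProcessed (u : V) (σ : State V) : State V :=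
  { σ with processed := insert u σ.processed }

/-- `direct_traffic(u)`. The recursion terminates since it only goes down the tree. -/
noncomputable def directTraffic [Fintype V] (agents : Finset V) (c : Choices G r)
    (u : V) (σ : State V) : State V :=
  let σ₁ := insertOwn agents u σ
  let σ₂ := (c.negOrder σ₁ u).foldl
    (fun τ v => directTraffic agents c v (setStart u v τ)) σ₁
  let σ₃ := (σ₂.l u).foldl (fun τ t => sendAgent c u t τ) σ₂
  let σ₄ := markProcessed u σ₃
  (c.restOrder σ₄ u).foldl (fun τ v => directTraffic agents c v τ) σ₄
termination_by (Finset.univ.sup (G.dist r)) - G.dist r u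
decreasing_by
  all_goals
    rename_i hv
    first
      | rw [c.mem_negOrder] at hv
      | rw [c.mem_restOrder] at hv
    have h1 := hv.1.2
    have h2 := Finset.le_sup (f := G.dist r) (Finset.mem_univ v)
    omega

/-- The plan output by `direct_traffic(r)`, run from the initial demands, with all lists empty,
all `s(u) = 0` and no node processed. -/
noncomputable def directTrafficPlan [Fintype V] (agents targets : Finset V) (c : Choices G r) :
    List (Move V) :=
  (directTraffic agents c r
    { d := initialDemand G r agents targets
      l := fun _ => []
      s := fun _ => 0
      processed := ∅
      out := [] }).out

end Algorithm

/-! ### Feasible plans -/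

/-- `plan` is a feasible, collision-free plan for unlabeled MAPF on the graph `G`. An agent is
identified with its starting node, and `pos a t` is the position of the agent `a` at timestep
`t`. -/
def IsFeasiblePlan {V : Type*} (G : SimpleGraph V) (agents targets : Finset V)
    (plan : List (Move V)) : Prop :=
  plan.Nodup ∧
  ∃ pos : agents → ℕ → V,
    -- every agent starts at its starting node
    (∀ a, pos a 0 = a) ∧
    -- in every timestep an agent waits or moves along an edge
    (∀ a t, pos a (t + 1) = pos a t ∨ G.Adj (pos a t) (pos a (t + 1))) ∧
    -- the moves along edges are exactly the moves in the plan
    (∀ v w t, (⟨v, w, t⟩ : Move V) ∈ plan ↔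
      v ≠ w ∧ ∃ a, pos a t = v ∧ pos a (t + 1) = w) ∧
    -- every agent ends at a target, where it stays forever
    (∀ a, ∃ b ∈ targets, ∃ t₀, ∀ t, t₀ ≤ t → pos a t = b) ∧
    -- no two agents occupy a vertex at the same time
    (∀ a b t, a ≠ b → pos a t ≠ pos b t) ∧
    -- no two agents swap along an edge
    (∀ a b t, a ≠ b → ¬ (pos a (t + 1) = pos b t ∧ pos b (t + 1) = pos a t))

end TreeMAPF

namespace TreeMAPF

/-! ### Rooted trees: unique parents, disjoint subtrees, conservation of demand. -/

section RootedTreeLemmas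

variable {V : Type*} {G : SimpleGraph V} {r : V}

/-! Write `D` for the initial demand. The edge between `u` and a child `v` carries `|D v|` agents,
all upwards if `D v < 0` and all downwards if `D v > 0` (`GoodMove`), so swaps cannot occur. By
conservation of demand (`initialDemand_eq`, `traffic_balance`), the own agent and the arrivals at a
vertex exceed its departures by one if it is a target and match them otherwise.

The local condition `Settled` adds timing: the entries of `l w` increase strictly, and the departure
times are these entries, except possibly the last at a target. So an agent waits only before its
start or at its final target, leaves every other vertex the moment it arrives, and never meets
another agent. `isFeasiblePlan_of_settled` makes this precise through the invariant `MayOccupy`.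

Every vertex gets settled by induction over the recursive calls (`directTraffic_spec`), with `Ready`
and `TrafficSpec` as pre- and postcondition. The crux is that `l u` stays sorted: the choice of `s
v` makes traffic rising from `v` reach `u` after everything already listed (`negLoop_spec`), and
lists are forwarded in order. `sendSpec_foldl` shows that the list has exactly the length needed. -/

theorem IsChild.parent_unique (hG : G.IsTree) {u u' v : V} (h : IsChild G r u v)
    (h' : IsChild G r u' v) : u = u' := by
  obtain ⟨p, hp⟩ := hG.connected.exists_walk_length_eq_dist r u
  obtain ⟨p', hp'⟩ := hG.connected.exists_walk_length_eq_dist r u'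
  -- A geodesic extended by the edge to `v` is again a geodesic, hence a path, and a tree has only
  -- one path from `r` to `v`.
  have e := (hG.existsUnique_path r v).unique
    (SimpleGraph.Walk.isPath_of_length_eq_dist (p.concat h.1) (by simp [hp, h.2]))
    (SimpleGraph.Walk.isPath_of_length_eq_dist (p'.concat h'.1) (by simp [hp', h'.2]))
  obtain ⟨e, -⟩ := SimpleGraph.Walk.concat_inj e
  exact e

theorem IsChild.parent_eq (hG : G.IsTree) {u v : V} (h : IsChild G r u v) :
    parent G r v = u := by
  have hex : ∃ p, IsChild G r p v := ⟨u, h⟩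
  rw [parent, dif_pos hex]
  exact hex.choose_spec.parent_unique hG h

theorem IsChild.ne {u v : V} (h : IsChild G r u v) : u ≠ v := h.1.ne

theorem IsChild.asymm {u v : V} (h : IsChild G r u v) : ¬ IsChild G r v u := fun h' => by
  have := h.2
  have := h'.2
  omega

theorem exists_isChild_of_ne_root (hG : G.IsTree) {v : V} (hv : v ≠ r) :
    ∃ u, IsChild G r u v := by
  obtain ⟨p, hp⟩ := hG.connected.exists_walk_length_eq_dist v r
  cases p with
  | nil => exact absurd rfl hv
  | @cons _ u _ h q =>
    refine ⟨u, h.symm, ?_⟩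
    have h1 := SimpleGraph.dist_le q
    rw [SimpleGraph.Walk.length_cons] at hp
    rw [SimpleGraph.dist_comm (u := u)] at h1
    rw [SimpleGraph.dist_comm] at hp
    have := hG.dist_eq_dist_add_one_of_adj r h
    omega

theorem inSubtree_root (hG : G.IsTree) (v : V) : InSubtree G r r v := by
  induction hn : G.dist r v generalizing v with
  | zero =>
    rw [hG.connected.dist_eq_zero_iff] at hn
    exact hn ▸ .refl
  | succ n ih =>
    obtain ⟨u, hu⟩ := exists_isChild_of_ne_root hG (r := r) (v := v) (by rintro rfl; simp at hn)
    exact (ih u (by have := hu.2; omega)).tail hu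

theorem InSubtree.dist_le {u v : V} (h : InSubtree G r u v) : G.dist r u ≤ G.dist r v := by
  induction h with
  | refl => rfl
  | tail _ h ih => have := h.2; omega

theorem InSubtree.eq_of_dist_eq {u v : V} (h : InSubtree G r u v)
    (hd : G.dist r u = G.dist r v) : u = v := by
  rcases Relation.ReflTransGen.cases_head h with h | ⟨w, hw, hwv⟩
  · exact h
  · have := InSubtree.dist_le hwv
    have := hw.2
    omega

theorem inSubtree_iff {u w : V} :
    InSubtree G r u w ↔ w = u ∨ ∃ v, IsChild G r u v ∧ InSubtree G r v w :=
  Relation.ReflTransGen.cases_head_iff.trans (by rw [eq_comm]; rfl)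

theorem IsChild.not_inSubtree {u v : V} (h : IsChild G r u v) : ¬ InSubtree G r v u :=
  fun h' => by
    have := h'.dist_le
    have := h.2
    omega

theorem IsChild.inSubtree {u v : V} (h : IsChild G r u v) : InSubtree G r u v := .single h

/-- Since parents are unique, the ancestors of `w` form a chain, in which two of equal depth
coincide. This keeps the calls at siblings independent. -/
theorem InSubtree.child_unique (hG : G.IsTree) {u v v' w : V} (h : IsChild G r u v)
    (h' : IsChild G r u v') (hw : InSubtree G r v w) (hw' : InSubtree G r v' w) : v = v' := by
  have hd : G.dist r v = G.dist r v' := by rw [h.2, h'.2]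
  rcases Relation.ReflTransGen.total_of_right_unique (r := Function.swap (IsChild G r))
    (fun _ _ _ h₁ h₂ => IsChild.parent_unique hG h₁ h₂)
    (Relation.ReflTransGen.swap _ _ hw) (Relation.ReflTransGen.swap _ _ hw') with h₁ | h₁
  · exact (InSubtree.eq_of_dist_eq (Relation.ReflTransGen.swap _ _ h₁) hd.symm).symm
  · exact InSubtree.eq_of_dist_eq (Relation.ReflTransGen.swap _ _ h₁) hd

open Classical in
/-- The children of `u`. -/
noncomputable def children [Fintype V] (G : SimpleGraph V) (r u : V) : Finset V :=
  Finset.univ.filter (IsChild G r u)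

theorem mem_children [Fintype V] {u v : V} : v ∈ children G r u ↔ IsChild G r u v := by
  simp [children]

open Classical in
theorem card_filter_inSubtree [Fintype V] (hG : G.IsTree) (S : Finset V) (u : V) :
    (S.filter (InSubtree G r u)).card =
      (if u ∈ S then 1 else 0) +
        ∑ v ∈ children G r u, (S.filter (InSubtree G r v)).card := by
  have h1 : S.filter (InSubtree G r u) =
      (S.filter (· = u)) ∪ (children G r u).biUnion fun v => S.filter (InSubtree G r v) := by
    ext w
    simp only [Finset.mem_filter, Finset.mem_union, Finset.mem_biUnion, mem_children]
    rw [inSubtree_iff]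
    grind
  rw [h1, Finset.card_union_of_disjoint, Finset.card_biUnion]
  · have h2 : (S.filter (· = u)).card = if u ∈ S then 1 else 0 := by
      rw [← Finset.card_singleton u, ← Finset.card_empty (α := V), ← apply_ite Finset.card]
      congr 1
      ext w
      split_ifs <;> grind
    rw [h2]
  · intro v hv v' hv' hne
    rw [Finset.mem_coe, mem_children] at hv hv'
    rw [Function.onFun, Finset.disjoint_left]
    intro w hw hw'
    exact hne (InSubtree.child_unique hG hv hv' (Finset.mem_filter.1 hw).2
      (Finset.mem_filter.1 hw').2)
  · rw [Finset.disjoint_left]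
    intro w hw hw'
    simp only [Finset.mem_filter, Finset.mem_biUnion, mem_children] at hw hw'
    obtain ⟨v, hv, -, h⟩ := hw'
    exact hv.not_inSubtree (hw.2 ▸ h)

open Classical in
-- Flow conservation at `u`: `T_u` is the disjoint union of `u` and the subtrees of its children.
theorem initialDemand_eq [Fintype V] (hG : G.IsTree) (agents targets : Finset V) (u : V) :
    initialDemand G r agents targets u =
      (if u ∈ targets then 1 else 0) - (if u ∈ agents then 1 else 0) +
        ∑ v ∈ children G r u, initialDemand G r agents targets v := by
  simp only [initialDemand, Finset.sum_sub_distrib]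
  rw [card_filter_inSubtree hG targets u, card_filter_inSubtree hG agents u]
  push_cast
  ring

theorem initialDemand_root (hG : G.IsTree) {agents targets : Finset V}
    (hcard : agents.card = targets.card) : initialDemand G r agents targets r = 0 := by
  simp [initialDemand, inSubtree_root hG, hcard]

end RootedTreeLemmas

/-! ### From settled vertices to a feasible plan -/

section Plans

variable {V : Type*} {G : SimpleGraph V} {r : V}

/-- Moves go up out of subtrees with negative demand and down into subtrees with positive
demand. -/
def GoodMove (G : SimpleGraph V) (r : V) (D : V → ℤ) (m : Move V) : Prop :=
  (D m.src < 0 ∧ IsChild G r m.dst m.src) ∨ (0 < D m.dst ∧ IsChild G r m.src m.dst)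

theorem GoodMove.adj {D : V → ℤ} {m : Move V} (h : GoodMove G r D m) : G.Adj m.src m.dst :=
  h.elim (fun h => h.2.1.symm) fun h => h.2.1

/-- The sign of the demand at the lower end of an edge fixes its direction once and for all, so the
two times need not be related. -/
theorem GoodMove.not_swap {D : V → ℤ} {v w : V} {t t' : ℕ} (h : GoodMove G r D ⟨v, w, t⟩) :
    ¬ GoodMove G r D ⟨w, v, t'⟩ := by
  rcases h with ⟨h1, h2⟩ | ⟨h1, h2⟩ <;> rintro (⟨h3, h4⟩ | ⟨h3, h4⟩) <;> dsimp only at *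
  · exact h2.asymm h4
  · omega
  · omega
  · exact h2.asymm h4

open Classical in
/-- The position at time `t + 1` of an agent which is at `v` at time `t`. -/
noncomputable def nextPos (M : List (Move V)) (t : ℕ) (v : V) : V :=
  if h : ∃ w, ⟨v, w, t⟩ ∈ M then h.choose else v

/-- The trajectory of an agent starting at `v`. -/
noncomputable def trajectory (M : List (Move V)) (v : V) : ℕ → V
  | 0 => v
  | t + 1 => nextPos M t (trajectory M v t)

theorem nextPos_mem {M : List (Move V)} {t : ℕ} {v : V} (h : ∃ w, ⟨v, w, t⟩ ∈ M) :
    ⟨v, nextPos M t v, t⟩ ∈ M := by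
  rw [nextPos, dif_pos h]
  exact h.choose_spec

theorem nextPos_eq_self {M : List (Move V)} {t : ℕ} {v : V} (h : ¬ ∃ w, ⟨v, w, t⟩ ∈ M) :
    nextPos M t v = v := dif_neg h

variable [DecidableEq V]

/-- The arrival times at `w` in a list of moves. -/
def inTimes (w : V) (M : List (Move V)) : List ℕ :=
  (M.filter fun m => m.dst = w).map fun m => m.time + 1

/-- The departure times from `w` in a list of moves. -/
def outTimes (w : V) (M : List (Move V)) : List ℕ :=
  (M.filter fun m => m.src = w).map Move.time

theorem mem_inTimes {w : V} {M : List (Move V)} {t : ℕ} :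
    t ∈ inTimes w M ↔ ∃ v t', ⟨v, w, t'⟩ ∈ M ∧ t = t' + 1 := by
  simp only [inTimes, List.mem_map, List.mem_filter, decide_eq_true_eq]
  constructor
  · rintro ⟨⟨v, w', t'⟩, ⟨h, rfl⟩, rfl⟩
    exact ⟨v, t', h, rfl⟩
  · rintro ⟨v, t', h, rfl⟩
    exact ⟨_, ⟨h, rfl⟩, rfl⟩

theorem mem_outTimes {w : V} {M : List (Move V)} {t : ℕ} :
    t ∈ outTimes w M ↔ ∃ v, ⟨w, v, t⟩ ∈ M := by
  simp only [outTimes, List.mem_map, List.mem_filter, decide_eq_true_eq]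
  constructor
  · rintro ⟨⟨v, w', t'⟩, ⟨h, rfl⟩, rfl⟩
    exact ⟨w', h⟩
  · rintro ⟨v, h⟩
    exact ⟨_, ⟨h, rfl⟩, rfl⟩

theorem inTimes_append (w : V) (M M' : List (Move V)) :
    inTimes w (M ++ M') = inTimes w M ++ inTimes w M' := by
  simp [inTimes]

theorem outTimes_append (w : V) (M M' : List (Move V)) :
    outTimes w (M ++ M') = outTimes w M ++ outTimes w M' := by
  simp [outTimes]

theorem inTimes_singleton (w u v : V) (t : ℕ) :
    inTimes w [⟨u, v, t⟩] = if v = w then [t + 1] else [] := by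
  by_cases h : v = w <;> simp [inTimes, h]

theorem outTimes_singleton (w u v : V) (t : ℕ) :
    outTimes w [⟨u, v, t⟩] = if u = w then [t] else [] := by
  by_cases h : u = w <;> simp [outTimes, h]

theorem src_unique {v v' w : V} {t : ℕ} {M : List (Move V)} (hM : (inTimes w M).Nodup)
    (h : ⟨v, w, t⟩ ∈ M) (h' : ⟨v', w, t⟩ ∈ M) : v = v' := by
  have := List.inj_on_of_nodup_map hM (x := ⟨v, w, t⟩) (by simp [h]) (y := ⟨v', w, t⟩)
    (by simp [h']) rfl
  exact congrArg Move.src this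

theorem dst_unique {v w w' : V} {t : ℕ} {M : List (Move V)} (hM : (outTimes v M).Nodup)
    (h : ⟨v, w, t⟩ ∈ M) (h' : ⟨v, w', t⟩ ∈ M) : w = w' := by
  have := List.inj_on_of_nodup_map hM (x := ⟨v, w, t⟩) (by simp [h]) (y := ⟨v, w', t⟩)
    (by simp [h']) rfl
  exact congrArg Move.dst this

theorem nodup_of_outTimes {M : List (Move V)} (hM : ∀ w, (outTimes w M).Nodup) : M.Nodup := by
  induction M with
  | nil => exact .nil
  | cons m M ih =>
    have h := hM m.src
    simp only [outTimes, decide_true, List.filter_cons_of_pos, List.map_cons,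
      List.nodup_cons] at h
    refine List.nodup_cons.2 ⟨fun hm => h.1 ?_, ih fun w => ?_⟩
    · exact List.mem_map_of_mem (List.mem_filter.2 ⟨hm, by simp⟩)
    · have h' := hM w
      rw [← List.singleton_append, outTimes_append] at h'
      exact (List.nodup_append.1 h').2.1

/-- The state of `w` once the traffic through it has been settled: `l(w)` lists, in increasing
order, the starting time of the own agent and the arrivals, and all of the agents leave at the
listed times except possibly the last one, which stays if `w` is a target. -/
structure Settled (agents targets : Finset V) (σ : State V) (w : V) : Prop where
  l_eq : σ.l w = (if w ∈ agents then [σ.s w] else []) ++ inTimes w σ.out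
  sorted : (σ.l w).Pairwise (· < ·)
  outTimes_eq : outTimes w σ.out = σ.l w ∨
    w ∈ targets ∧ ∃ t, σ.l w = outTimes w σ.out ++ [t]

/-- An agent may be at `w` at time `t`. -/
def MayOccupy (agents targets : Finset V) (σ : State V) (w : V) (t : ℕ) : Prop :=
  (w ∈ agents ∧ t ≤ σ.s w) ∨ t ∈ σ.l w ∨
    (w ∈ targets ∧ ∃ t' ≤ t, t' ∈ σ.l w ∧ ∀ t'' ∈ σ.l w, t'' ≤ t')

section

variable {agents targets : Finset V} {σ : State V} {D : V → ℤ}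

theorem Settled.nodup_inTimes {w : V} (h : Settled agents targets σ w) :
    (inTimes w σ.out).Nodup := by
  have := h.sorted
  rw [h.l_eq, List.pairwise_append] at this
  exact this.2.1.imp fun h => h.ne

theorem Settled.outTimes_sublist {w : V} (h : Settled agents targets σ w) :
    (outTimes w σ.out).Sublist (σ.l w) := by
  rcases h.outTimes_eq with h | ⟨-, t, h⟩ <;> simp [h]

theorem Settled.nodup_outTimes {w : V} (h : Settled agents targets σ w) :
    (outTimes w σ.out).Nodup :=
  (h.sorted.imp fun h => h.ne).sublist h.outTimes_sublist

theorem Settled.mem_l_of_arrival {v w : V} {t : ℕ} (h : Settled agents targets σ w)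
    (hm : ⟨v, w, t⟩ ∈ σ.out) : t + 1 ∈ σ.l w := by
  rw [h.l_eq]
  exact List.mem_append_right _ (mem_inTimes.2 ⟨v, t, hm, rfl⟩)

theorem Settled.mem_l_of_departure {v w : V} {t : ℕ} (h : Settled agents targets σ v)
    (hm : ⟨v, w, t⟩ ∈ σ.out) : t ∈ σ.l v :=
  h.outTimes_sublist.subset (mem_outTimes.2 ⟨w, hm⟩)

theorem Settled.start_lt_arrival {v w : V} {t : ℕ} (h : Settled agents targets σ w)
    (hw : w ∈ agents) (hm : ⟨v, w, t⟩ ∈ σ.out) : σ.s w < t + 1 := by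
  have := h.sorted
  rw [h.l_eq, if_pos hw, List.singleton_append, List.pairwise_cons] at this
  exact this.1 _ (mem_inTimes.2 ⟨v, t, hm, rfl⟩)

theorem Settled.start_le {w : V} {t : ℕ} (h : Settled agents targets σ w)
    (hw : w ∈ agents) (ht : t ∈ σ.l w) : σ.s w ≤ t := by
  have := h.sorted
  rw [h.l_eq, if_pos hw, List.singleton_append] at this ht
  rcases List.mem_cons.1 ht with rfl | ht
  · rfl
  · exact ((List.pairwise_cons.1 this).1 _ ht).le

theorem Settled.start_mem {w : V} (h : Settled agents targets σ w)
    (hw : w ∈ agents) : σ.s w ∈ σ.l w := by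
  rw [h.l_eq, if_pos hw]
  simp

/-- Only the final entry of `l w` can lack a departure, and sortedness makes it the largest. -/
theorem Settled.last_of_stays {w : V} {t : ℕ} (h : Settled agents targets σ w)
    (ht : t ∈ σ.l w) (hn : ¬ ∃ x, ⟨w, x, t⟩ ∈ σ.out) :
    w ∈ targets ∧ ∀ t' ∈ σ.l w, t' ≤ t := by
  rw [← mem_outTimes] at hn
  rcases h.outTimes_eq with h' | ⟨hw, t₀, h'⟩
  · exact absurd (h' ▸ ht) hn
  · refine ⟨hw, fun t' ht' => ?_⟩
    have hs := h.sorted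
    rw [h', List.pairwise_append] at hs
    rw [h', List.mem_append, List.mem_singleton] at ht ht'
    rcases ht with ht | rfl
    · exact absurd ht hn
    · rcases ht' with ht' | rfl
      · exact (hs.2.2 t' ht' t (by simp)).le
      · rfl

theorem MayOccupy.next (hS : ∀ w, Settled agents targets σ w) {v : V} {t : ℕ}
    (h : MayOccupy agents targets σ v t) :
    MayOccupy agents targets σ (nextPos σ.out t v) (t + 1) := by
  by_cases hm : ∃ w, ⟨v, w, t⟩ ∈ σ.out
  · exact Or.inr (Or.inl ((hS _).mem_l_of_arrival (nextPos_mem hm)))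
  · rw [nextPos_eq_self hm]
    have key : t ∈ σ.l v → MayOccupy agents targets σ v (t + 1) := fun ht =>
      have h' := (hS v).last_of_stays ht hm
      Or.inr (Or.inr ⟨h'.1, t, by omega, ht, h'.2⟩)
    rcases h with ⟨hv, hle⟩ | ht | ⟨hv, t', hle, ht'⟩
    · rcases hle.eq_or_lt with rfl | hlt
      · exact key ((hS v).start_mem hv)
      · exact Or.inl ⟨hv, hlt⟩
    · exact key ht
    · exact Or.inr (Or.inr ⟨hv, t', by omega, ht'⟩)

/-- An agent that stays either still waits for its start, which precedes all arrivals, or is the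
last one listed. An arrival would list `t + 1`, contradicting both. -/
theorem MayOccupy.not_arrival (hS : ∀ w, Settled agents targets σ w) {u v : V} {t : ℕ}
    (h : MayOccupy agents targets σ v t) (hm : ¬ ∃ w, ⟨v, w, t⟩ ∈ σ.out) :
    ⟨u, v, t⟩ ∉ σ.out := fun hu => by
  have hl := (hS v).mem_l_of_arrival hu
  have key : t ∉ σ.l v := fun ht => by
    have := ((hS v).last_of_stays ht hm).2 _ hl
    omega
  rcases h with ⟨hv, hle⟩ | ht | ⟨hv, t', hle, -, ht'⟩
  · have h1 := (hS v).start_lt_arrival hv hu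
    have h2 : t = σ.s v := by omega
    exact key (h2 ▸ (hS v).start_mem hv)
  · exact key ht
  · have := ht' _ hl
    omega

/-- Two movers with a common destination would repeat an arrival time, and nobody enters a vertex
whose occupant stays. -/
theorem nextPos_injective_of_mayOccupy (hS : ∀ w, Settled agents targets σ w) {v v' : V} {t : ℕ}
    (h : MayOccupy agents targets σ v t) (h' : MayOccupy agents targets σ v' t)
    (he : nextPos σ.out t v = nextPos σ.out t v') : v = v' := by
  by_cases hm : ∃ w, ⟨v, w, t⟩ ∈ σ.out <;> by_cases hm' : ∃ w, ⟨v', w, t⟩ ∈ σ.out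
  · exact src_unique (hS _).nodup_inTimes (nextPos_mem hm) (he ▸ nextPos_mem hm')
  · rw [nextPos_eq_self hm'] at he
    exact absurd (he ▸ nextPos_mem hm) (h'.not_arrival hS hm')
  · rw [nextPos_eq_self hm] at he
    exact absurd (he ▸ nextPos_mem hm') (h.not_arrival hS hm)
  · rwa [nextPos_eq_self hm, nextPos_eq_self hm'] at he

theorem mayOccupy_trajectory (hS : ∀ w, Settled agents targets σ w) {a : V} (ha : a ∈ agents)
    (t : ℕ) : MayOccupy agents targets σ (trajectory σ.out a t) t := by
  induction t with
  | zero => exact Or.inl ⟨ha, Nat.zero_le _⟩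
  | succ t ih => exact ih.next hS

theorem trajectory_eq_start (hS : ∀ w, Settled agents targets σ w) {a : V} (ha : a ∈ agents)
    {t : ℕ} (ht : t ≤ σ.s a) : trajectory σ.out a t = a := by
  induction t with
  | zero => rfl
  | succ t ih =>
    rw [trajectory, ih (by omega), nextPos_eq_self]
    rintro ⟨w, hw⟩
    have := (hS a).start_le ha ((hS a).mem_l_of_departure hw)
    omega

theorem nextPos_eq {v w : V} {t : ℕ} (hS : ∀ w, Settled agents targets σ w)
    (h : ⟨v, w, t⟩ ∈ σ.out) : nextPos σ.out t v = w :=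
  dst_unique (hS v).nodup_outTimes (nextPos_mem ⟨w, h⟩) h

/-- Trace arrivals back in time until an agent's start is reached. Hence no output move lacks an
agent to perform it. -/
theorem exists_trajectory_eq (hS : ∀ w, Settled agents targets σ w) {t : ℕ} {w : V}
    (ht : t ∈ σ.l w) : ∃ a ∈ agents, trajectory σ.out a t = w := by
  induction t using Nat.strong_induction_on generalizing w with
  | _ t ih =>
    rw [(hS w).l_eq, List.mem_append] at ht
    rcases ht with ht | ht
    · split_ifs at ht with hw
      · rw [List.mem_singleton] at ht
        exact ⟨w, hw, trajectory_eq_start hS hw ht.le⟩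
      · simp at ht
    · obtain ⟨v, t', hm, rfl⟩ := mem_inTimes.1 ht
      obtain ⟨a, ha, he⟩ := ih t' (by omega) ((hS v).mem_l_of_departure hm)
      exact ⟨a, ha, by rw [trajectory, he, nextPos_eq hS hm]⟩

theorem isFeasiblePlan_of_settled [Fintype V] (hS : ∀ w, Settled agents targets σ w)
    (hM : ∀ m ∈ σ.out, GoodMove G r D m) : IsFeasiblePlan G agents targets σ.out := by
  have hadj : ∀ t v, nextPos σ.out t v = v ∨
      ⟨v, nextPos σ.out t v, t⟩ ∈ σ.out := fun t v => by
    by_cases hm : ∃ w, ⟨v, w, t⟩ ∈ σ.out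
    · exact .inr (nextPos_mem hm)
    · exact .inl (nextPos_eq_self hm)
  have hinj : ∀ (a b : agents) t, a ≠ b →
      trajectory σ.out (a : V) t ≠ trajectory σ.out (b : V) t := fun a b t hab => by
    induction t with
    | zero => exact fun h => hab (Subtype.ext h)
    | succ t ih =>
      exact fun h => ih (nextPos_injective_of_mayOccupy hS (mayOccupy_trajectory hS a.2 t)
        (mayOccupy_trajectory hS b.2 t) h)
  refine ⟨nodup_of_outTimes fun w => (hS w).nodup_outTimes,
    fun a t => trajectory σ.out (a : V) t, fun a => rfl, fun a t => ?_, fun v w t => ?_,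
    fun a => ?_, hinj, fun a b t hab => ?_⟩
  · exact (hadj t _).imp id fun h => (hM _ h).adj
  · constructor
    · intro h
      obtain ⟨a, ha, he⟩ := exists_trajectory_eq hS ((hS v).mem_l_of_departure h)
      exact ⟨(hM _ h).adj.ne, ⟨a, ha⟩, he,
        (congrArg _ he).trans (nextPos_eq hS h)⟩
    · rintro ⟨hne, a, rfl, rfl⟩
      exact (hadj t _).resolve_left fun h => hne h.symm
  -- Beyond the largest start or listed time `T`, nothing moves, and only the target alternative of
  -- `MayOccupy` survives.
  · obtain ⟨T, hT⟩ := (Finset.univ.image σ.s ∪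
      Finset.univ.biUnion fun w => (σ.l w).toFinset).bddAbove
    have hs : ∀ w, σ.s w ≤ T := fun w => hT (by simp)
    have hl : ∀ w, ∀ t ∈ σ.l w, t ≤ T := fun w t ht => hT (by simp; exact Or.inr ⟨w, ht⟩)
    refine ⟨trajectory σ.out (a : V) (T + 1), ?_, T + 1, fun t ht => ?_⟩
    · rcases mayOccupy_trajectory hS a.2 (T + 1) with ⟨-, h⟩ | h | ⟨h, -⟩
      · have := hs (trajectory σ.out (a : V) (T + 1))
        omega
      · have := hl _ _ h
        omega
      · exact h
    · induction t, ht using Nat.le_induction with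
      | base => rfl
      | succ t ht ih =>
        refine (nextPos_eq_self ?_).trans ih
        rintro ⟨w, hw⟩
        have := hl _ _ ((hS _).mem_l_of_departure hw)
        omega
  · rintro ⟨h1, h2⟩
    simp only [trajectory] at h1 h2
    -- Distinct agents are at distinct vertices, so both really move, using one edge in both
    -- directions.
    have hne := hinj a b t hab
    have hA := (hadj t (trajectory σ.out (a : V) t)).resolve_left fun h => hne (h.symm.trans h1)
    have hB := (hadj t (trajectory σ.out (b : V) t)).resolve_left
      fun h => hne (h2.symm.trans h)
    rw [h1] at hA
    rw [h2] at hB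
    exact (hM _ hA).not_swap (hM _ hB)

end

end Plans

/-! ### Sending the agents listed at one vertex -/

section SendAgent

variable {V : Type*} {G : SimpleGraph V} {r : V}

open Classical in
/-- The number of agents which `u` has to send to its neighbor `w` if the demands are `d`. -/
noncomputable def transfers (G : SimpleGraph V) (r : V) (d : V → ℤ) (u w : V) : ℕ :=
  if IsChild G r u w then (d w).toNat else if IsChild G r w u then (-d u).toNat else 0

theorem transfers_child {d : V → ℤ} {u w : V} (h : IsChild G r u w) :
    transfers G r d u w = (d w).toNat := if_pos h

theorem transfers_parent {d : V → ℤ} {u w : V} (h : IsChild G r w u) :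
    transfers G r d u w = (-d u).toNat := by
  rw [transfers, if_neg h.asymm, if_pos h]

theorem transfers_other {d : V → ℤ} {u w : V} (h : ¬ IsChild G r u w) (h' : ¬ IsChild G r w u) :
    transfers G r d u w = 0 := by
  rw [transfers, if_neg h, if_neg h']

theorem transfers_self {d : V → ℤ} {u : V} : transfers G r d u u = 0 :=
  transfers_other (fun h => h.ne rfl) fun h => h.ne rfl

variable [DecidableEq V]

/-- The effect of sending on the agents of the list `L` from `u`, which is a target if `b`
holds. -/
structure SendSpec (G : SimpleGraph V) (r u : V) (b : Prop) (L : List ℕ) (σ τ : State V) :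
    Prop where
  s_eq : τ.s = σ.s
  processed_eq : τ.processed = σ.processed
  d_self : τ.d u = 0
  d_child : ∀ w, IsChild G r u w → τ.d w = min (σ.d w) 0
  d_other : ∀ w, w ≠ u → ¬ IsChild G r u w → τ.d w = σ.d w
  arrivals : ∀ w, ∃ X : List ℕ, X.Sublist (L.map (· + 1)) ∧ τ.l w = σ.l w ++ X ∧
    inTimes w τ.out = inTimes w σ.out ++ X ∧ X.length = transfers G r σ.d u w
  outTimes_ne : ∀ w, w ≠ u → outTimes w τ.out = outTimes w σ.out
  outTimes_self : ∃ Y, outTimes u τ.out = outTimes u σ.out ++ Y ∧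
    (Y = L ∨ b ∧ ∃ t, L = Y ++ [t])
  moves : ∀ m ∈ τ.out, m ∈ σ.out ∨ m.src = u ∧
    ((σ.d u < 0 ∧ IsChild G r m.dst u) ∨ (0 < σ.d m.dst ∧ IsChild G r u m.dst))

/-- Prepends a single move to a run. The hypotheses cover moves to the parent and to a child alike,
leaving only the demands to be checked in each case. -/
theorem SendSpec.cons {u w₀ : V} {b : Prop} {t : ℕ} {L : List ℕ} {σ σ' τ : State V}
    (h : SendSpec G r u b L σ' τ) (hs : σ'.s = σ.s) (hp : σ'.processed = σ.processed)
    (hl : σ'.l = Function.update σ.l w₀ (σ.l w₀ ++ [t + 1]))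
    (hout : σ'.out = σ.out ++ [⟨u, w₀, t⟩])
    (hmin : ∀ w, IsChild G r u w → min (σ'.d w) 0 = min (σ.d w) 0)
    (hd : ∀ w, w ≠ u → ¬ IsChild G r u w → σ'.d w = σ.d w)
    (htr : ∀ w, transfers G r σ.d u w =
      transfers G r σ'.d u w + if w₀ = w then 1 else 0)
    (hu : σ'.d u < 0 → σ.d u < 0) (hle : ∀ w, IsChild G r u w → σ'.d w ≤ σ.d w)
    (hgood : (σ.d u < 0 ∧ IsChild G r w₀ u) ∨ (0 < σ.d w₀ ∧ IsChild G r u w₀)) :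
    SendSpec G r u b (t :: L) σ τ where
  s_eq := h.s_eq.trans hs
  processed_eq := h.processed_eq.trans hp
  d_self := h.d_self
  d_child w hw := (h.d_child w hw).trans (hmin w hw)
  d_other w hw hw' := (h.d_other w hw hw').trans (hd w hw hw')
  arrivals w := by
    obtain ⟨X, hX, hlX, hin, hlen⟩ := h.arrivals w
    rw [hl] at hlX
    rw [hout, inTimes_append, inTimes_singleton] at hin
    by_cases hw : w₀ = w
    · subst hw
      refine ⟨(t + 1) :: X, hX.cons_cons _, ?_, ?_, ?_⟩
      · simpa using hlX
      · simpa using hin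
      · rw [htr, if_pos rfl, ← hlen, List.length_cons]
    · refine ⟨X, hX.cons _, ?_, ?_, ?_⟩
      · simpa [Function.update_of_ne (Ne.symm hw)] using hlX
      · simpa [hw] using hin
      · rw [htr, if_neg hw, hlen, add_zero]
  outTimes_ne w hw := by
    rw [h.outTimes_ne w hw, hout, outTimes_append, outTimes_singleton, if_neg (Ne.symm hw),
      List.append_nil]
  outTimes_self := by
    obtain ⟨Y, hY, hb⟩ := h.outTimes_self
    refine ⟨t :: Y, ?_, hb.imp (congrArg _) fun ⟨hb, t', h⟩ => ⟨hb, t', by simp [h]⟩⟩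
    rw [hY, hout, outTimes_append, outTimes_singleton, if_pos rfl]
    simp
  moves m hm := by
    rcases h.moves m hm with h | ⟨hsrc, h⟩
    · rw [hout, List.mem_append, List.mem_singleton] at h
      rcases h with h | rfl
      · exact .inl h
      · exact .inr ⟨rfl, hgood⟩
    · refine .inr ⟨hsrc, h.imp (fun h => ⟨hu h.1, h.2⟩) fun h => ⟨?_, h.2⟩⟩
      have := hle _ h.2
      omega

variable [Fintype V]

/-- `hlen` counts the transfers due, plus one if `b`, and each real move lowers both sides by one.
So the list cannot run out early, and at most its last entry stays. -/
theorem sendSpec_foldl (hG : G.IsTree) (c : Choices G r) {u : V} {b : Prop} [Decidable b]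
    (L : List ℕ) (σ : State V) (hparent : σ.d u < 0 → IsChild G r (parent G r u) u)
    (hd : σ.d u ≤ 0)
    (hlen : (L.length : ℤ) = -σ.d u + ∑ v ∈ children G r u, max (σ.d v) 0 +
      if b then 1 else 0) :
    SendSpec G r u b L σ (L.foldl (fun τ t => sendAgent c u t τ) σ) := by
  have hsum : ∀ d : V → ℤ, 0 ≤ ∑ v ∈ children G r u, max (d v) 0 := fun d =>
    Finset.sum_nonneg fun v _ => le_max_right _ _
  have hb : (0 : ℤ) ≤ if b then 1 else 0 := by split_ifs <;> simp
  -- nothing remains to be sent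
  have hnil : ∀ (L : List ℕ) (σ : State V), σ.d u = 0 →
      ∑ v ∈ children G r u, max (σ.d v) 0 = 0 → (L = [] ∨ b ∧ ∃ t, L = [t]) →
      SendSpec G r u b L σ σ := fun L σ h0 hs hL => by
    have hv : ∀ v, IsChild G r u v → σ.d v ≤ 0 := fun v hv => by
      have := (Finset.sum_eq_zero_iff_of_nonneg fun v _ => le_max_right _ _).1 hs v
        (mem_children.2 hv)
      exact max_eq_right_iff.1 this
    refine ⟨rfl, rfl, h0, fun w hw => (min_eq_left (hv w hw)).symm, fun _ _ _ => rfl,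
      fun w => ⟨[], by simp, by simp, by simp, ?_⟩, fun _ _ => rfl,
      ⟨[], by simp, ?_⟩, fun m hm => .inl hm⟩
    · rw [transfers]
      split_ifs with h
      · have := hv w h
        simp; omega
      · simp [h0]
      · rfl
    · rcases hL with rfl | ⟨h, t, rfl⟩
      · exact .inl rfl
      · exact .inr ⟨h, t, rfl⟩
  induction L generalizing σ with
  | nil =>
    have := hsum σ.d
    simp only [List.length_nil, Nat.cast_zero] at hlen
    exact hnil _ _ (by omega) (by omega) (.inl rfl)
  | cons t L ih =>
    rw [List.foldl_cons]
    rw [List.length_cons] at hlen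
    push_cast at hlen
    by_cases hneg : σ.d u < 0
    · have hp := hparent hneg
      have hstep : sendAgent c u t σ = { σ with
        l := Function.update σ.l (parent G r u) (σ.l (parent G r u) ++ [t + 1])
        out := σ.out ++ [⟨u, parent G r u, t⟩]
        d := Function.update σ.d u (σ.d u + 1) } := by rw [sendAgent, if_pos hneg]
      have hdc : ∀ w, w ≠ u → (sendAgent c u t σ).d w = σ.d w := fun w hw => by
        rw [hstep]; exact Function.update_of_ne hw _ _
      have hdu : (sendAgent c u t σ).d u = σ.d u + 1 := by
        rw [hstep]; exact Function.update_self _ _ _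
      refine (ih _ (fun _ => hp) (by omega) ?_).cons (w₀ := parent G r u)
        (by rw [hstep]) (by rw [hstep]) (by rw [hstep]) (by rw [hstep])
        (fun w hw => by rw [hdc w hw.ne.symm]) (fun w hw _ => hdc w hw) (fun w => ?_)
        (fun _ => hneg) (fun w hw => (hdc w hw.ne.symm).le) (.inl ⟨hneg, hp⟩)
      · rw [Finset.sum_congr rfl fun v hv => by
          rw [hdc v (mem_children.1 hv).ne.symm], hdu]
        omega
      · by_cases hw : parent G r u = w
        · subst hw
          rw [transfers_parent hp, transfers_parent hp, hdu, if_pos rfl]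
          omega
        · have hw' : ¬ IsChild G r w u := fun h => hw (h.parent_eq hG)
          rw [if_neg hw, add_zero]
          by_cases h : IsChild G r u w
          · rw [transfers_child h, transfers_child h, hdc w h.ne.symm]
          · rw [transfers_other h hw', transfers_other h hw']
    · have h0 : σ.d u = 0 := by omega
      by_cases hex : ∃ v, IsChild G r u v ∧ 0 < σ.d v
      · obtain ⟨hc, hpos⟩ := c.pick_spec σ u hex
        have hstep : sendAgent c u t σ = { σ with
          l := Function.update σ.l (c.pick σ u) (σ.l (c.pick σ u) ++ [t + 1])
          out := σ.out ++ [⟨u, c.pick σ u, t⟩]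
          d := Function.update σ.d (c.pick σ u) (σ.d (c.pick σ u) - 1) } := by
          rw [sendAgent, if_neg hneg, if_pos hex]
        generalize c.pick σ u = v₀ at hc hpos hstep
        have hdc : ∀ w, w ≠ v₀ → (sendAgent c u t σ).d w = σ.d w := fun w hw => by
          rw [hstep]; exact Function.update_of_ne hw _ _
        have hdv : (sendAgent c u t σ).d v₀ = σ.d v₀ - 1 := by
          rw [hstep]; exact Function.update_self _ _ _
        have hdu : (sendAgent c u t σ).d u = 0 := by rw [hdc u hc.ne, h0]
        refine (ih _ (fun h => by omega) (by omega) ?_).cons (w₀ := v₀)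
          (by rw [hstep]) (by rw [hstep]) (by rw [hstep]) (by rw [hstep])
          (fun w hw => ?_) (fun w _ hw => hdc w ?_) (fun w => ?_)
          (fun h => by omega) (fun w hw => ?_) (.inr ⟨hpos, hc⟩)
        · rw [← Finset.add_sum_erase _ _ (mem_children.2 hc)] at hlen ⊢
          rw [Finset.sum_congr rfl fun v hv => by rw [hdc v (Finset.ne_of_mem_erase hv)],
            hdu, hdv]
          omega
        · by_cases h : w = v₀
          · subst h
            rw [hdv]
            omega
          · rw [hdc w h]
        · rintro rfl
          exact hw hc
        · by_cases h : v₀ = w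
          · subst h
            rw [transfers_child hc, transfers_child hc, hdv, if_pos rfl]
            omega
          · rw [if_neg h, add_zero, transfers, transfers, hdc w (Ne.symm h), hdu, h0]
        · by_cases h : w = v₀
          · subst h
            rw [hdv]
            omega
          · rw [hdc w h]
      · have hstep : sendAgent c u t σ = σ := by rw [sendAgent, if_neg hneg, if_neg hex]
        have hs : ∑ v ∈ children G r u, max (σ.d v) 0 = 0 :=
          Finset.sum_eq_zero fun v hv => max_eq_right (not_lt.1 fun h =>
            hex ⟨v, mem_children.1 hv, h⟩)
        -- With nothing left to send, the length count forces `t` to be the last entry and `b` to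
        -- hold.
        have hL : L = [] ∧ b := by
          rw [← List.length_eq_zero_iff]
          split_ifs at hlen with h
          · exact ⟨by omega, h⟩
          · omega
        rw [hstep, hL.1]
        exact hnil _ _ h0 hs (.inr ⟨hL.2, t, rfl⟩)

end SendAgent

/-! ### Pre- and postconditions of a call, and the loops over children -/

section Traffic

variable {V : Type*} {G : SimpleGraph V} {r : V} [DecidableEq V]

/-- The two states agree on everything that concerns `w`. -/
structure Agree (σ τ : State V) (w : V) : Prop where
  d_eq : τ.d w = σ.d w
  l_eq : τ.l w = σ.l w
  s_eq : τ.s w = σ.s w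
  inTimes_eq : inTimes w τ.out = inTimes w σ.out
  outTimes_eq : outTimes w τ.out = outTimes w σ.out
  processed_iff : w ∈ τ.processed ↔ w ∈ σ.processed

theorem Agree.trans {σ τ ρ : State V} {w : V} (h : Agree σ τ w) (h' : Agree τ ρ w) :
    Agree σ ρ w where
  d_eq := h'.d_eq.trans h.d_eq
  l_eq := h'.l_eq.trans h.l_eq
  s_eq := h'.s_eq.trans h.s_eq
  inTimes_eq := h'.inTimes_eq.trans h.inTimes_eq
  outTimes_eq := h'.outTimes_eq.trans h.outTimes_eq
  processed_iff := h'.processed_iff.trans h.processed_iff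

/-- The traffic through `w` has been settled and `w` is marked as processed. -/
def Done (agents targets : Finset V) (σ : State V) (w : V) : Prop :=
  Settled agents targets σ w ∧ w ∈ σ.processed

theorem Done.of_agree {agents targets : Finset V} {σ τ : State V} {w : V}
    (h : Done agents targets σ w) (ha : Agree σ τ w) : Done agents targets τ w where
  left :=
    { l_eq := by rw [ha.l_eq, ha.s_eq, ha.inTimes_eq, h.1.l_eq]
      sorted := by rw [ha.l_eq]; exact h.1.sorted
      outTimes_eq := by rw [ha.l_eq, ha.outTimes_eq]; exact h.1.outTimes_eq }
  right := ha.processed_iff.2 h.2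

/-- The state is as it should be when `direct_traffic(u)` is called. -/
structure Ready (G : SimpleGraph V) (r : V) (D : V → ℤ) (u : V) (σ : State V) : Prop where
  d_below : ∀ w, InSubtree G r u w → w ≠ u → σ.d w = D w
  l_below : ∀ w, InSubtree G r u w → w ≠ u → σ.l w = []
  s_below : ∀ w, InSubtree G r u w → w ≠ u → σ.s w = 0
  inTimes_eq : ∀ w, InSubtree G r u w → inTimes w σ.out = σ.l w
  outTimes_eq : ∀ w, InSubtree G r u w → outTimes w σ.out = []
  not_processed : ∀ w, InSubtree G r u w → w ∉ σ.processed
  d_self : σ.d u = min (D u) 0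
  length_l : (σ.l u).length = (D u).toNat
  sorted_l : (σ.l u).Pairwise (· < ·)
  pos_of_mem_l : ∀ t ∈ σ.l u, 0 < t
  s_self : 0 ≤ D u → σ.s u = 0

theorem Ready.of_agree {D : V → ℤ} {u : V} {σ τ : State V} (h : Ready G r D u σ)
    (ha : ∀ w, InSubtree G r u w → Agree σ τ w) : Ready G r D u τ where
  d_below w hw hne := (ha w hw).d_eq.trans (h.d_below w hw hne)
  l_below w hw hne := (ha w hw).l_eq.trans (h.l_below w hw hne)
  s_below w hw hne := (ha w hw).s_eq.trans (h.s_below w hw hne)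
  inTimes_eq w hw := by rw [(ha w hw).inTimes_eq, (ha w hw).l_eq, h.inTimes_eq w hw]
  outTimes_eq w hw := (ha w hw).outTimes_eq.trans (h.outTimes_eq w hw)
  not_processed w hw := by rw [(ha w hw).processed_iff]; exact h.not_processed w hw
  d_self := (ha u .refl).d_eq.trans h.d_self
  length_l := by rw [(ha u .refl).l_eq, h.length_l]
  sorted_l := by rw [(ha u .refl).l_eq]; exact h.sorted_l
  pos_of_mem_l := by rw [(ha u .refl).l_eq]; exact h.pos_of_mem_l
  s_self h0 := (ha u .refl).s_eq.trans (h.s_self h0)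

theorem setStart_agree {u v w : V} {σ : State V} (hw : w ≠ v) : Agree σ (setStart u v σ) w :=
  ⟨rfl, rfl, Function.update_of_ne hw _ _, rfl, rfl, Iff.rfl⟩

/-- At `v`, `Ready` constrains `s v` only when the demand is nonnegative. -/
theorem Ready.setStart {D : V → ℤ} {u v : V} {σ : State V} (h : Ready G r D v σ)
    (hv : D v < 0) : Ready G r D v (setStart u v σ) where
  d_below := h.d_below
  l_below := h.l_below
  s_below w hw hne := (setStart_agree hne).s_eq.trans (h.s_below w hw hne)
  inTimes_eq := h.inTimes_eq
  outTimes_eq := h.outTimes_eq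
  not_processed := h.not_processed
  d_self := h.d_self
  length_l := h.length_l
  sorted_l := h.sorted_l
  pos_of_mem_l := h.pos_of_mem_l
  s_self h0 := absurd hv h0.not_gt

/-- The effect of `direct_traffic(u)`. -/
structure TrafficSpec (G : SimpleGraph V) (r : V) (D : V → ℤ) (agents targets : Finset V) (u : V)
    (σ τ : State V) : Prop where
  done : ∀ w, InSubtree G r u w → Done agents targets τ w
  d_self : τ.d u = 0
  agree : ∀ w, ¬ InSubtree G r u w → (D u < 0 → ¬ IsChild G r w u) → Agree σ τ w
  parent : ∀ w, IsChild G r w u → τ.d w = σ.d w ∧ τ.s w = σ.s w ∧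
    outTimes w τ.out = outTimes w σ.out ∧ (w ∈ τ.processed ↔ w ∈ σ.processed) ∧
    ∃ X : List ℕ, τ.l w = σ.l w ++ X ∧ inTimes w τ.out = inTimes w σ.out ++ X ∧
      X.length = (-D u).toNat ∧ X.Pairwise (· < ·) ∧ ∀ t ∈ X, σ.s u < t
  moves : ∀ m ∈ τ.out, m ∈ σ.out ∨ GoodMove G r D m

theorem le_maxTime {L : List ℕ} {t : ℕ} (h : t ∈ L) : t ≤ maxTime L := by
  induction L with
  | nil => simp at h
  | cons a L ih =>
    rcases List.mem_cons.1 h with rfl | h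
    · exact le_max_left _ _
    · exact (ih h).trans (le_max_right _ _)

/-- A call at `v` affects only `T_v` and possibly the parent `u`, and the subtree of a sibling
avoids both. -/
theorem TrafficSpec.agree_sibling (hG : G.IsTree) {D : V → ℤ} {agents targets : Finset V} {u v v' : V} {σ τ : State V}
    (h : TrafficSpec G r D agents targets v σ τ) (hv : IsChild G r u v) (hv' : IsChild G r u v')
    (hne : v' ≠ v) {w : V} (hw : InSubtree G r v' w) : Agree σ τ w :=
  h.agree w (fun h => hne (InSubtree.child_unique hG hv' hv hw h))
    fun _ h => hv'.not_inSubtree (h.parent_unique hG hv ▸ hw)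

variable [Fintype V]

section Loops

variable {D : V → ℤ} {agents targets : Finset V} {c : Choices G r} {u : V}

/-- The two terms in `s v` have separate uses: `max l(u)` keeps `l u` sorted while arrivals are
appended, and `s(u) - 1` ensures that none of them precedes `s u`. -/
theorem negLoop_spec (hG : G.IsTree)
    (ih : ∀ v, IsChild G r u v → ∀ σ, Ready G r D v σ →
      TrafficSpec G r D agents targets v σ (directTraffic agents c v σ))
    (L : List V) (hL : L.Nodup) (hchild : ∀ v ∈ L, IsChild G r u v) (hneg : ∀ v ∈ L, D v < 0)
    (σ τ : State V) (hready : ∀ v ∈ L, Ready G r D v σ) (hsorted : (σ.l u).Pairwise (· < ·))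
    (hτ : L.foldl (fun τ v => directTraffic agents c v (setStart u v τ)) σ = τ) :
    (∀ v ∈ L, τ.d v = 0 ∧ ∀ w, InSubtree G r v w → Done agents targets τ w) ∧
    (∀ w, w ≠ u → (∀ v ∈ L, ¬ InSubtree G r v w) → Agree σ τ w) ∧
    τ.d u = σ.d u ∧ τ.s u = σ.s u ∧ outTimes u τ.out = outTimes u σ.out ∧
    (τ.l u).Pairwise (· < ·) ∧
    (∃ X : List ℕ, τ.l u = σ.l u ++ X ∧ inTimes u τ.out = inTimes u σ.out ++ X ∧
      X.length = (L.map fun v => (-D v).toNat).sum ∧ ∀ t ∈ X, σ.s u ≤ t) ∧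
    ∀ m ∈ τ.out, m ∈ σ.out ∨ GoodMove G r D m := by
  induction L generalizing σ with
  | nil =>
    subst hτ
    exact ⟨by simp, fun w _ _ => ⟨rfl, rfl, rfl, rfl, rfl, Iff.rfl⟩, rfl, rfl, rfl, hsorted,
      ⟨[], by simp⟩, fun m hm => .inl hm⟩
  | cons v L ihL =>
    rw [List.foldl_cons] at hτ
    obtain ⟨hvL, hL⟩ := List.nodup_cons.1 hL
    have hv := hchild v (by simp)
    have hvneg := hneg v (by simp)
    have hspec := ih v hv _ ((hready v (by simp)).setStart (u := u) hvneg)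
    generalize directTraffic agents c v (setStart u v σ) = σ' at hτ hspec
    have hsv : (setStart u v σ).s v = max (σ.s u - 1) (maxTime (σ.l u)) :=
      Function.update_self _ _ _
    have huv : Agree σ (setStart u v σ) u := setStart_agree hv.ne
    obtain ⟨hd, hs, ho, -, X, hlX, hiX, hXlen, hXs, hXlt⟩ := hspec.parent u hv
    rw [hsv] at hXlt
    have hsorted' : (σ'.l u).Pairwise (· < ·) := by
      rw [hlX, List.pairwise_append]
      exact ⟨hsorted, hXs, fun t ht t' ht' =>
        ((le_maxTime ht).trans (le_max_right _ _)).trans_lt (hXlt t' ht')⟩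
    obtain ⟨h1, h2, h3, h4, h5, h6, ⟨Y, hY1, hY2, hY3, hY4⟩, h7⟩ :=
      ihL hL (fun v' h => hchild v' (by simp [h])) (fun v' h => hneg v' (by simp [h])) σ'
        (fun v' h => (hready v' (by simp [h])).of_agree fun w hw =>
          have hne : v' ≠ v := fun e => hvL (e ▸ h)
          have hwv : w ≠ v := fun e =>
            hne (InSubtree.child_unique hG (hchild v' (by simp [h])) hv hw (e ▸ .refl))
          (setStart_agree hwv).trans
            (hspec.agree_sibling hG hv (hchild v' (by simp [h])) hne hw)) hsorted' hτ
    have hkeep : ∀ w, InSubtree G r v w → Agree σ' τ w := fun w hw =>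
      h2 w (fun e => hv.not_inSubtree (e ▸ hw)) fun v' hv' hw' =>
        hvL (InSubtree.child_unique hG hv (hchild v' (by simp [hv'])) hw hw' ▸ hv')
    refine ⟨fun v' hv' => ?_, fun w hwu hw => ?_, h3.trans hd, ?_, h5.trans ho, h6,
      ⟨X ++ Y, ?_, ?_, ?_, ?_⟩, fun m hm => ?_⟩
    · rcases List.mem_cons.1 hv' with rfl | hv'
      · exact ⟨(hkeep _ .refl).d_eq.trans hspec.d_self,
          fun w hw => (hspec.done w hw).of_agree (hkeep w hw)⟩
      · exact h1 v' hv'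
    · have hwv := hw v (by simp)
      exact ((setStart_agree (by rintro rfl; exact hwv .refl)).trans
        (hspec.agree w hwv fun _ h => hwu (h.parent_unique hG hv))).trans
          (h2 w hwu fun v' hv' => hw v' (by simp [hv']))
    · rw [h4, hs, huv.s_eq]
    · rw [hY1, hlX, List.append_assoc, huv.l_eq]
    · rw [hY2, hiX, List.append_assoc, huv.inTimes_eq]
    · simp [hXlen, hY3]
    · intro t ht
      rcases List.mem_append.1 ht with ht | ht
      -- Arriving strictly after `s u - 1` means arriving no earlier than `s u`.
      · have := (le_max_left _ _).trans_lt (hXlt t ht)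
        omega
      · have := hY4 t ht
        rwa [hs, huv.s_eq] at this
    · exact (h7 m hm).elim (hspec.moves m) .inr

/-- Children of nonnegative demand send nothing up, so unlike in `negLoop_spec` even `u` is
unaffected. -/
theorem restLoop_spec (hG : G.IsTree)
    (ih : ∀ v, IsChild G r u v → ∀ σ, Ready G r D v σ →
      TrafficSpec G r D agents targets v σ (directTraffic agents c v σ))
    (L : List V) (hL : L.Nodup) (hchild : ∀ v ∈ L, IsChild G r u v) (hnonneg : ∀ v ∈ L, 0 ≤ D v)
    (σ τ : State V) (hready : ∀ v ∈ L, Ready G r D v σ)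
    (hτ : L.foldl (fun τ v => directTraffic agents c v τ) σ = τ) :
    (∀ v ∈ L, ∀ w, InSubtree G r v w → Done agents targets τ w) ∧
    (∀ w, (∀ v ∈ L, ¬ InSubtree G r v w) → Agree σ τ w) ∧
    ∀ m ∈ τ.out, m ∈ σ.out ∨ GoodMove G r D m := by
  induction L generalizing σ with
  | nil =>
    subst hτ
    exact ⟨by simp, fun w _ => ⟨rfl, rfl, rfl, rfl, rfl, Iff.rfl⟩, fun m hm => .inl hm⟩
  | cons v L ihL =>
    rw [List.foldl_cons] at hτ
    obtain ⟨hvL, hL⟩ := List.nodup_cons.1 hL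
    have hv := hchild v (by simp)
    have hv0 := hnonneg v (by simp)
    have hspec := ih v hv _ (hready v (by simp))
    generalize directTraffic agents c v σ = σ' at hτ hspec
    obtain ⟨h1, h2, h3⟩ :=
      ihL hL (fun v' h => hchild v' (by simp [h])) (fun v' h => hnonneg v' (by simp [h])) σ'
        (fun v' h => (hready v' (by simp [h])).of_agree fun w hw =>
          hspec.agree_sibling hG hv (hchild v' (by simp [h])) (fun e => hvL (e ▸ h)) hw) hτ
    refine ⟨fun v' hv' w hw => ?_, fun w hw => ?_,
      fun m hm => (h3 m hm).elim (hspec.moves m) .inr⟩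
    · rcases List.mem_cons.1 hv' with rfl | hv'
      · exact (hspec.done w hw).of_agree (h2 w fun v'' hv'' hw' =>
          hvL (InSubtree.child_unique hG hv (hchild v'' (by simp [hv''])) hw hw' ▸ hv''))
      · exact h1 v' hv' w hw
    · exact (hspec.agree w (hw v (by simp)) fun h => absurd h hv0.not_gt).trans
        (h2 w fun v' hv' => hw v' (by simp [hv']))

end Loops

end Traffic

/-! ### Correctness of the recursion -/

section Correctness

variable {V : Type*} {G : SimpleGraph V} {r : V} [DecidableEq V]
  {agents targets : Finset V}

theorem insertOwn_agree {u w : V} {σ : State V} (hw : w ≠ u) :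
    Agree σ (insertOwn agents u σ) w := by
  rw [insertOwn]
  split_ifs
  · exact ⟨rfl, Function.update_of_ne hw _ _, rfl, rfl, rfl, Iff.rfl⟩
  · exact ⟨rfl, rfl, rfl, rfl, rfl, Iff.rfl⟩

theorem insertOwn_l {u : V} {σ : State V} :
    (insertOwn agents u σ).l u = (if u ∈ agents then [σ.s u] else []) ++ σ.l u := by
  rw [insertOwn]
  split_ifs
  · exact Function.update_self _ _ _
  · rfl

theorem SendSpec.agree {u w : V} {b : Prop} {L : List ℕ} {σ τ : State V}
    (h : SendSpec G r u b L σ τ) (hw : w ≠ u) (h0 : transfers G r σ.d u w = 0) :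
    Agree σ (markProcessed u τ) w where
  d_eq := by
    by_cases hc : IsChild G r u w
    · rw [transfers_child hc] at h0
      exact (h.d_child w hc).trans (min_eq_left (by omega))
    · exact h.d_other w hw hc
  l_eq := by
    obtain ⟨X, -, hX, -, hlen⟩ := h.arrivals w
    rw [List.length_eq_zero_iff.1 (hlen.trans h0), List.append_nil] at hX
    exact hX
  s_eq := congrFun h.s_eq w
  inTimes_eq := by
    obtain ⟨X, -, -, hX, hlen⟩ := h.arrivals w
    rw [List.length_eq_zero_iff.1 (hlen.trans h0), List.append_nil] at hX
    exact hX
  outTimes_eq := h.outTimes_ne w hw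
  processed_iff := by
    rw [markProcessed, Finset.mem_insert, h.processed_eq]
    exact or_iff_right hw

/-- Such a child awaits no agents from `u`, so it can be called before `u` sends anything. -/
theorem Ready.child_of_neg {D : V → ℤ} {u v : V} {σ : State V} (h : Ready G r D u σ)
    (hv : IsChild G r u v) (hneg : D v < 0) : Ready G r D v σ := by
  have hsub : ∀ w, InSubtree G r v w → InSubtree G r u w ∧ w ≠ u := fun w hw =>
    ⟨inSubtree_iff.2 (.inr ⟨v, hv, hw⟩), fun e => hv.not_inSubtree (e ▸ hw)⟩
  have hl := h.l_below v hv.inSubtree hv.ne.symm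
  exact
    { d_below := fun w hw _ => h.d_below w (hsub w hw).1 (hsub w hw).2
      l_below := fun w hw _ => h.l_below w (hsub w hw).1 (hsub w hw).2
      s_below := fun w hw _ => h.s_below w (hsub w hw).1 (hsub w hw).2
      inTimes_eq := fun w hw => h.inTimes_eq w (hsub w hw).1
      outTimes_eq := fun w hw => h.outTimes_eq w (hsub w hw).1
      not_processed := fun w hw => h.not_processed w (hsub w hw).1
      d_self := by rw [h.d_below v hv.inSubtree hv.ne.symm, min_eq_left hneg.le]
      length_l := by rw [hl, List.length_nil, Int.toNat_of_nonpos hneg.le]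
      sorted_l := by simp [hl]
      pos_of_mem_l := by simp [hl]
      s_self := fun h0 => absurd hneg h0.not_gt }

theorem ready_initial (hG : G.IsTree) (hcard : agents.card = targets.card) :
    Ready G r (initialDemand G r agents targets) r
      { d := initialDemand G r agents targets
        l := fun _ => []
        s := fun _ => 0
        processed := ∅
        out := [] } := by
  have h0 := initialDemand_root (r := r) hG hcard
  constructor <;> simp [inTimes, outTimes, h0]

variable [Fintype V]

/-- The left side is the final length of `l u`, the right side counts departures and a possible
stay. It is `initialDemand_eq` with demands split into positive and negative parts. -/
theorem traffic_balance (hG : G.IsTree) {D : V → ℤ} (hD : D = initialDemand G r agents targets)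
    (u : V) {L : List V} (hL : L.Nodup) (hmem : ∀ v, v ∈ L ↔ IsChild G r u v ∧ D v < 0) :
    (((if u ∈ agents then 1 else 0) + (D u).toNat + (L.map fun v => (-D v).toNat).sum : ℕ) : ℤ) =
      -min (D u) 0 + ∑ v ∈ children G r u, max (D v) 0 + if u ∈ targets then 1 else 0 := by
  have h1 := initialDemand_eq (r := r) hG agents targets u
  rw [← hD] at h1
  have h2 : (((L.map fun v => (-D v).toNat).sum : ℕ) : ℤ) = ∑ v ∈ children G r u, max (-D v) 0 := by
    rw [← List.sum_toFinset (fun v => (-D v).toNat) hL]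
    simp only [Nat.cast_sum, Int.ofNat_toNat]
    apply Finset.sum_subset
    · intro v hv
      exact mem_children.2 ((hmem v).1 (List.mem_toFinset.1 hv)).1
    · intro v hv hv'
      rw [List.mem_toFinset, hmem, not_and] at hv'
      have := hv' (mem_children.1 hv)
      omega
  have h3 : ∑ v ∈ children G r u, max (D v) 0 =
      ∑ v ∈ children G r u, D v + ∑ v ∈ children G r u, max (-D v) 0 := by
    rw [← Finset.sum_add_distrib]
    exact Finset.sum_congr rfl fun v _ => by omega
  push_cast at h1 h2 ⊢
  rw [h2, h3]
  split_ifs at h1 ⊢ <;> omega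

theorem directTraffic_spec_of_children (hG : G.IsTree) (hcard : agents.card = targets.card)
    {D : V → ℤ} (hD : D = initialDemand G r agents targets) {c : Choices G r} {u : V}
    (ih : ∀ v, IsChild G r u v → ∀ σ, Ready G r D v σ →
      TrafficSpec G r D agents targets v σ (directTraffic agents c v σ))
    {σ : State V} (hσ : Ready G r D u σ) :
    TrafficSpec G r D agents targets u σ (directTraffic agents c u σ) := by
  rw [directTraffic]
  generalize e₁ : insertOwn agents u σ = σ₁
  generalize e₂ : List.foldl (fun τ v => directTraffic agents c v (setStart u v τ)) σ₁
    (c.negOrder σ₁ u) = σ₂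
  generalize e₃ : List.foldl (fun τ t => sendAgent c u t τ) σ₂ (σ₂.l u) = σ₃
  generalize e₄ : markProcessed u σ₃ = σ₄
  generalize e₅ : List.foldl (fun τ v => directTraffic agents c v τ) σ₄ (c.restOrder σ₄ u) = τ
  have hu₁ : σ₁.d u = σ.d u ∧ σ₁.s u = σ.s u ∧ σ₁.out = σ.out := by
    rw [← e₁, insertOwn]
    split_ifs <;> exact ⟨rfl, rfl, rfl⟩
  obtain ⟨hd₁, hs₁, ho₁⟩ := hu₁
  have ha₁ : ∀ w, w ≠ u → Agree σ σ₁ w := fun w hw => e₁ ▸ insertOwn_agree hw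
  have hl₁ : σ₁.l u = (if u ∈ agents then [σ.s u] else []) ++ σ.l u := e₁ ▸ insertOwn_l
  have hne : ∀ {v w}, IsChild G r u v → InSubtree G r v w → w ≠ u :=
    fun hv hw e => hv.not_inSubtree (e ▸ hw)
  have hsub : ∀ {v w}, IsChild G r u v → InSubtree G r v w → InSubtree G r u w :=
    fun hv hw => inSubtree_iff.2 (.inr ⟨_, hv, hw⟩)
  -- the loop over the children with negative demand
  have hmem : ∀ v, v ∈ c.negOrder σ₁ u ↔ IsChild G r u v ∧ D v < 0 := fun v => by
    rw [c.mem_negOrder]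
    refine and_congr_right fun hv => ?_
    rw [(ha₁ v hv.ne.symm).d_eq, hσ.d_below v hv.inSubtree hv.ne.symm]
  have hbal := traffic_balance hG hD u (c.negOrder_nodup σ₁ u) hmem
  have hl_nil : D u < 0 → σ.l u = [] := fun h => by
    rw [← List.length_eq_zero_iff, hσ.length_l, Int.toNat_of_nonpos h.le]
  have hsort₁ : (σ₁.l u).Pairwise (· < ·) := by
    rw [hl₁, List.pairwise_append]
    refine ⟨by split_ifs <;> simp, hσ.sorted_l, fun t ht t' ht' => ?_⟩
    -- Entries present before the loop came from the parent, so `D u ≥ 0` and the own agent starts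
    -- at `0`, before these positive times.
    have h0 : 0 ≤ D u := by
      by_contra h
      simp [hl_nil (not_le.1 h)] at ht'
    split_ifs at ht
    · rw [List.mem_singleton.1 ht, hσ.s_self h0]
      exact hσ.pos_of_mem_l t' ht'
    · simp at ht
  obtain ⟨hdone₂, ha₂, hd₂, hs₂, ho₂, hsort₂, ⟨X, hlX, hiX, hXlen, hXle⟩, hm₂⟩ :=
    negLoop_spec hG ih (c.negOrder σ₁ u) (c.negOrder_nodup σ₁ u)
      (fun v hv => ((hmem v).1 hv).1) (fun v hv => ((hmem v).1 hv).2) σ₁ σ₂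
      (fun v hv => (hσ.child_of_neg ((hmem v).1 hv).1 ((hmem v).1 hv).2).of_agree
        fun w hw => ha₁ w (hne ((hmem v).1 hv).1 hw)) hsort₁ e₂
  have hl₂ : σ₂.l u = (if u ∈ agents then [σ.s u] else []) ++ (σ.l u ++ X) := by
    rw [hlX, hl₁, List.append_assoc]
  have hkeep₂ : ∀ v, IsChild G r u v → 0 ≤ D v → ∀ w, InSubtree G r v w → Agree σ σ₂ w :=
    fun v hv h0 w hw => (ha₁ w (hne hv hw)).trans (ha₂ w (hne hv hw) fun v' hv' hw' => by
      obtain ⟨hv', hneg⟩ := (hmem v').1 hv'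
      rw [InSubtree.child_unique hG hv' hv hw' hw] at hneg
      omega)
  have hout₂ : ∀ w, ¬ InSubtree G r u w → Agree σ σ₂ w := fun w hw =>
    have hwu : w ≠ u := fun e => hw (e ▸ .refl)
    (ha₁ w hwu).trans (ha₂ w hwu fun v hv hw' => hw (hsub ((hmem v).1 hv).1 hw'))
  have hdu₂ : σ₂.d u = min (D u) 0 := by rw [hd₂, hd₁, hσ.d_self]
  -- The first loop cancels all negative demands of children and leaves the others alone.
  have hdc₂ : ∀ v, IsChild G r u v → σ₂.d v = max (D v) 0 := fun v hv => by
    by_cases h : D v < 0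
    · rw [(hdone₂ v ((hmem v).2 ⟨hv, h⟩)).1, max_eq_right h.le]
    · rw [(hkeep₂ v hv (not_lt.1 h) v .refl).d_eq, hσ.d_below v hv.inSubtree hv.ne.symm,
        max_eq_left (not_lt.1 h)]
  -- sending the agents
  have hsend := sendSpec_foldl (b := u ∈ targets) hG c (σ₂.l u) σ₂ (u := u)
    (fun h => by
      obtain ⟨p, hp⟩ := exists_isChild_of_ne_root hG (r := r) (v := u) (by
        rintro rfl
        rw [hdu₂, hD, initialDemand_root hG hcard] at h
        simp at h)
      rwa [hp.parent_eq hG])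
    (by omega)
    (by
      rw [hdu₂, Finset.sum_congr rfl fun v hv => by
        rw [hdc₂ v (mem_children.1 hv), max_eq_left (le_max_right _ _)], ← hbal, hl₂,
        List.length_append, List.length_append, hσ.length_l, hXlen, ← add_assoc]
      split_ifs <;> rfl)
  rw [e₃] at hsend
  have hkeep₄ : ∀ w, w ≠ u → transfers G r σ₂.d u w = 0 → Agree σ₂ σ₄ w :=
    fun w hw h0 => e₄ ▸ hsend.agree hw h0
  -- Sending reaches only neighbors of `u`, so nothing strictly below a child changes.
  have hinner : ∀ v, IsChild G r u v → ∀ w, InSubtree G r v w → w ≠ v →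
      transfers G r σ₂.d u w = 0 := fun v hv w hw hwv =>
    transfers_other (fun h => hwv (InSubtree.child_unique hG h hv .refl hw))
      fun h => h.not_inSubtree (hsub hv hw)
  have hdone₄ : ∀ v, IsChild G r u v → D v < 0 → ∀ w, InSubtree G r v w →
      Done agents targets σ₄ w := fun v hv hneg w hw => by
    obtain ⟨h0, hdone⟩ := hdone₂ v ((hmem v).2 ⟨hv, hneg⟩)
    refine (hdone w hw).of_agree (hkeep₄ w (hne hv hw) ?_)
    by_cases hwv : w = v
    · rw [hwv, transfers_child hv, h0, Int.toNat_zero]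
    · exact hinner v hv w hw hwv
  have hs₃ : σ₃.s u = σ.s u := by rw [hsend.s_eq, hs₂, hs₁]
  have hdone_u : Done agents targets σ₄ u := by
    obtain ⟨Z, -, hZl, hZi, hZlen⟩ := hsend.arrivals u
    rw [transfers_self, List.length_eq_zero_iff] at hZlen
    rw [hZlen, List.append_nil] at hZl hZi
    obtain ⟨Y, hY, hYL⟩ := hsend.outTimes_self
    rw [ho₂, ho₁, hσ.outTimes_eq u .refl, List.nil_append] at hY
    subst hY e₄
    refine ⟨⟨?_, ?_, ?_⟩, Finset.mem_insert_self _ _⟩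
    · simp only [markProcessed]
      rw [hZl, hZi, hiX, ho₁, hσ.inTimes_eq u .refl, hs₃, hl₂]
    · exact hZl ▸ hsort₂
    · simp only [markProcessed]
      rw [hZl]
      exact hYL
  have hready₄ : ∀ v, IsChild G r u v → 0 ≤ D v → Ready G r D v σ₄ := fun v hv h0 => by
    have hag : ∀ w, InSubtree G r v w → w ≠ v → Agree σ σ₄ w := fun w hw hwv =>
      (hkeep₂ v hv h0 w hw).trans (hkeep₄ w (hne hv hw) (hinner v hv w hw hwv))
    have hv₂ := hkeep₂ v hv h0 v .refl
    obtain ⟨Z, hZ, hZl, hZi, hZlen⟩ := hsend.arrivals v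
    rw [transfers_child hv, hdc₂ v hv, max_eq_left h0] at hZlen
    rw [hv₂.l_eq, hσ.l_below v hv.inSubtree hv.ne.symm, List.nil_append] at hZl
    rw [hv₂.inTimes_eq, hσ.inTimes_eq v hv.inSubtree, hσ.l_below v hv.inSubtree hv.ne.symm,
      List.nil_append] at hZi
    subst hZl e₄
    refine ⟨fun w hw hwv => ?_, fun w hw hwv => ?_, fun w hw hwv => ?_, fun w hw => ?_,
      fun w hw => ?_, fun w hw => ?_, ?_, hZlen, ?_, fun t ht => ?_, fun _ => ?_⟩
    · rw [(hag w hw hwv).d_eq, hσ.d_below w (hsub hv hw) (hne hv hw)]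
    · rw [(hag w hw hwv).l_eq, hσ.l_below w (hsub hv hw) (hne hv hw)]
    · rw [(hag w hw hwv).s_eq, hσ.s_below w (hsub hv hw) (hne hv hw)]
    · by_cases hwv : w = v
      · exact hwv ▸ hZi
      · rw [(hag w hw hwv).inTimes_eq, (hag w hw hwv).l_eq, hσ.inTimes_eq w (hsub hv hw)]
    · refine (hsend.outTimes_ne w (hne hv hw)).trans ?_
      rw [(hkeep₂ v hv h0 w hw).outTimes_eq, hσ.outTimes_eq w (hsub hv hw)]
    · rw [markProcessed, Finset.mem_insert, hsend.processed_eq,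
        (hkeep₂ v hv h0 w hw).processed_iff, not_or]
      exact ⟨hne hv hw, hσ.not_processed w (hsub hv hw)⟩
    · refine (hsend.d_child v hv).trans ?_
      rw [hdc₂ v hv, max_eq_left h0]
    · exact (List.Pairwise.map _ (fun _ _ h => by simpa using h) hsort₂).sublist hZ
    · obtain ⟨t', -, rfl⟩ := List.mem_map.1 (hZ.subset ht)
      exact Nat.succ_pos _
    · refine (congrFun hsend.s_eq v).trans ?_
      rw [hv₂.s_eq, hσ.s_below v hv.inSubtree hv.ne.symm]
  -- the loop over the remaining children
  have hmem' : ∀ v, v ∈ c.restOrder σ₄ u ↔ IsChild G r u v ∧ 0 ≤ D v := fun v => by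
    rw [c.mem_restOrder]
    refine and_congr_right fun hv => ⟨fun h => ?_, fun h => (hready₄ v hv h).not_processed v .refl⟩
    by_contra h'
    exact h (hdone₄ v hv (not_le.1 h') v .refl).2
  obtain ⟨hdone₅, ha₅, hm₅⟩ := restLoop_spec hG ih (c.restOrder σ₄ u)
    (c.restOrder_nodup σ₄ u) (fun v hv => ((hmem' v).1 hv).1) (fun v hv => ((hmem' v).1 hv).2)
    σ₄ τ (fun v hv => hready₄ v ((hmem' v).1 hv).1 ((hmem' v).1 hv).2) e₅
  have hau : Agree σ₄ τ u := ha₅ u fun v hv => ((hmem' v).1 hv).1.not_inSubtree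
  have hout₅ : ∀ w, ¬ InSubtree G r u w → Agree σ₄ τ w := fun w hw =>
    ha₅ w fun v hv h => hw (hsub ((hmem' v).1 hv).1 h)
  refine ⟨fun w hw => ?_, ?_, fun w hw hpar => ?_, fun w hw => ?_, fun m hm => ?_⟩
  · rcases inSubtree_iff.1 hw with rfl | ⟨v, hv, hw⟩
    · exact hdone_u.of_agree hau
    · by_cases hneg : D v < 0
      · refine (hdone₄ v hv hneg w hw).of_agree (ha₅ w fun v' hv' hw' => ?_)
        obtain ⟨hv', h0⟩ := (hmem' v').1 hv'
        rw [InSubtree.child_unique hG hv' hv hw' hw] at h0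
        omega
      · exact hdone₅ v ((hmem' v).2 ⟨hv, not_lt.1 hneg⟩) w hw
  · rw [hau.d_eq, ← e₄]
    exact hsend.d_self
  · refine ((hout₂ w hw).trans (hkeep₄ w (fun e => hw (e ▸ .refl)) ?_)).trans (hout₅ w hw)
    have hwc : ¬ IsChild G r u w := fun h => hw h.inSubtree
    by_cases hwu : IsChild G r w u
    · rw [transfers_parent hwu, hdu₂, min_eq_right (not_lt.1 fun h => hpar h hwu)]
      rfl
    · exact transfers_other hwc hwu
  · have hwsub := hw.not_inSubtree
    have hag := hout₂ w hwsub
    have hag' := hout₅ w hwsub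
    obtain ⟨Z, hZ, hZl, hZi, hZlen⟩ := hsend.arrivals w
    subst e₄
    have hDu : (-min (D u) 0).toNat = (-D u).toNat := by omega
    rw [transfers_parent hw, hdu₂, hDu] at hZlen
    refine ⟨?_, ?_, ?_, ?_, Z, ?_, ?_, hZlen, ?_, fun t ht => ?_⟩
    · rw [hag'.d_eq]
      exact (hsend.d_other w hw.ne hw.asymm).trans hag.d_eq
    · rw [hag'.s_eq]
      exact (congrFun hsend.s_eq w).trans hag.s_eq
    · rw [hag'.outTimes_eq]
      exact (hsend.outTimes_ne w hw.ne).trans hag.outTimes_eq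
    · rw [hag'.processed_iff, markProcessed, Finset.mem_insert, hsend.processed_eq,
        or_iff_right hw.ne, hag.processed_iff]
    · rw [hag'.l_eq, ← hag.l_eq]
      exact hZl
    · rw [hag'.inTimes_eq, ← hag.inTimes_eq]
      exact hZi
    · exact (List.Pairwise.map _ (fun _ _ h => by simpa using h) hsort₂).sublist hZ
    · have hneg : D u < 0 := by
        have := List.length_pos_of_mem ht
        omega
      obtain ⟨t', ht', rfl⟩ := List.mem_map.1 (hZ.subset ht)
      rw [hl₂, hl_nil hneg, List.nil_append, List.mem_append] at ht'
      -- Departures start no earlier than `s u`; the travel time of one makes the bound at the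
      -- parent strict.
      have : σ.s u ≤ t' := by
        rcases ht' with ht' | ht'
        · split_ifs at ht'
          · exact (List.mem_singleton.1 ht').ge
          · simp at ht'
        · exact hs₁ ▸ hXle t' ht'
      omega
  · rcases hm₅ m hm with hm | hm
    · subst e₄
      rcases hsend.moves m hm with hm | ⟨hsrc, ⟨h, hc⟩ | ⟨h, hc⟩⟩
      · exact ho₁ ▸ hm₂ m hm
      · exact .inr (.inl ⟨by rw [hsrc]; omega, hsrc ▸ hc⟩)
      · rw [hdc₂ _ hc] at h
        exact .inr (.inr ⟨by omega, hsrc ▸ hc⟩)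
    · exact .inr hm

theorem directTraffic_spec (hG : G.IsTree) (hcard : agents.card = targets.card)
    {D : V → ℤ} (hD : D = initialDemand G r agents targets) (c : Choices G r) (u : V)
    (σ : State V) (hσ : Ready G r D u σ) :
    TrafficSpec G r D agents targets u σ (directTraffic agents c u σ) := by
  induction hn : Finset.univ.sup (G.dist r) - G.dist r u using Nat.strong_induction_on
    generalizing u σ with
  | _ n ih =>
    refine directTraffic_spec_of_children hG hcard hD (fun v hv τ hτ => ih _ ?_ v τ hτ rfl) hσ
    have h1 := hv.2
    have h2 := Finset.le_sup (f := G.dist r) (Finset.mem_univ v)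
    omega

end Correctness

end TreeMAPF

theorem mainTheorem3 {V : Type*} [Fintype V] [DecidableEq V] (G : SimpleGraph V) (hG : G.IsTree)
    (r : V) (agents targets : Finset V) (hcard : agents.card = targets.card)
    (c : TreeMAPF.Choices G r) :
    TreeMAPF.IsFeasiblePlan G agents targets
      (TreeMAPF.directTrafficPlan agents targets c) := by
  have h := TreeMAPF.directTraffic_spec hG hcard rfl c r _ (TreeMAPF.ready_initial hG hcard)
  exact TreeMAPF.isFeasiblePlan_of_settled (D := TreeMAPF.initialDemand G r agents targets)
    (fun w => (h.done w (TreeMAPF.inSubtree_root hG w)).1)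
    fun m hm => (h.moves m hm).resolve_left (by simp)
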